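/- Let $m\ge 3$ and $n\ge 2$. The flower graph $Fl_m$ is the graph with vertices $u_0,u_1,\dots,u_{2m}$ in which $u_1,\dots,u_m$ form a cycle $u_1u_2\cdots u_mu_1$, each $u_{m+i}$ ($1\le i\le m$) is adjacent to $u_i$, and $u_0$ is adjacent to each of $u_1,\dots,u_{2m}$; there are no other edges. The star $K_{1,n}$ is the complete bipartite graph with parts of sizes $1$ and $n$. The tensor product $G\times H$ of graphs $G$ and $H$ has vertex set $V(G)\times V(H)$, with $(x_1,y_1)$ adjacent to $(x_2,y_2)$ if and only if $x_1x_2\in E(G)$ and $y_1y_2\in E(H)$. A finite simple graph $G$ with $q$ edges is antimagic if there is a bijection $f:E(G)\to\{1,2,\dots,q\}$ such that $\phi_f(u)\neq\phi_f(v)$ for all distinct vertices $u,v$, where $\phi_f(u)$ is the sum of $f(e)$ over the edges $e$ incident to $u$. Then the graph $Fl_m\times K_{1,n}$ has exactly $8mn$ edges and is antimagic. -/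

import Mathlib

namespace SimpleGraph

/-- The tensor (categorical) product of two simple graphs: `(a, b)` and `(a', b')` are adjacent
iff `a` is adjacent to `a'` and `b` is adjacent to `b'`. -/
def tensorProd {V W : Type*} (G : SimpleGraph V) (H : SimpleGraph W) : SimpleGraph (V × W) where
  Adj x y := G.Adj x.1 y.1 ∧ H.Adj x.2 y.2
  symm := ⟨fun _ _ h => ⟨h.1.symm, h.2.symm⟩⟩
  loopless := ⟨fun _ h => G.irrefl h.1⟩

instance instDecidableRelTensorProd {V W : Type*} (G : SimpleGraph V) (H : SimpleGraph W)
    [DecidableRel G.Adj] [DecidableRel H.Adj] : DecidableRel (tensorProd G H).Adj :=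
  fun x y => inferInstanceAs (Decidable (G.Adj x.1 y.1 ∧ H.Adj x.2 y.2))

/-- Adjacency in the flower graph. The hub is `none`, the rim vertices are `some (.inl i)` and
the outer vertices are `some (.inr i)`. -/
def FlowerAdj (m : ℕ) : Option (Fin m ⊕ Fin m) → Option (Fin m ⊕ Fin m) → Prop
  | none, none => False
  | none, some _ => True
  | some _, none => True
  | some (.inl i), some (.inl j) => (cycleGraph m).Adj i j
  | some (.inl i), some (.inr j) => i = j
  | some (.inr i), some (.inl j) => i = j
  | some (.inr _), some (.inr _) => False

/-- The flower graph `Fl_m` (for `m ≥ 3`): a cycle of `m` rim vertices, one outer vertex joined to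
each rim vertex, and a hub joined to all rim vertices and to all outer vertices. -/
def flowerGraph (m : ℕ) : SimpleGraph (Option (Fin m ⊕ Fin m)) where
  Adj := FlowerAdj m
  symm := ⟨by
    rintro (_ | i | i) (_ | j | j) h
    · exact h
    · trivial
    · trivial
    · trivial
    · exact SimpleGraph.Adj.symm (G := cycleGraph m) h
    · exact Eq.symm h
    · trivial
    · exact Eq.symm h
    · exact h⟩
  loopless := ⟨by
    rintro (_ | i | i) h
    · exact h
    · exact (cycleGraph m).irrefl h
    · exact h⟩

instance instDecidableRelFlowerGraph (m : ℕ) : DecidableRel (flowerGraph m).Adj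
  | none, none => inferInstanceAs (Decidable False)
  | none, some _ => inferInstanceAs (Decidable True)
  | some _, none => inferInstanceAs (Decidable True)
  | some (.inl i), some (.inl j) => inferInstanceAs (Decidable ((cycleGraph m).Adj i j))
  | some (.inl i), some (.inr j) => inferInstanceAs (Decidable (i = j))
  | some (.inr i), some (.inl j) => inferInstanceAs (Decidable (i = j))
  | some (.inr _), some (.inr _) => inferInstanceAs (Decidable False)

/-- The star `K_{1,n}`, as a complete bipartite graph. -/
def starK (n : ℕ) : SimpleGraph (Fin 1 ⊕ Fin n) := completeBipartiteGraph (Fin 1) (Fin n)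

instance instDecidableRelStarK (n : ℕ) : DecidableRel (starK n).Adj :=
  fun v w => inferInstanceAs
    (Decidable ((v.isLeft = true ∧ w.isRight = true) ∨ (v.isRight = true ∧ w.isLeft = true)))

/-- A finite graph with `q` edges is antimagic if there is a bijection `f` from its edge set onto
`{1, …, q}` such that distinct vertices have distinct sums of the labels of their incident edges. -/
def IsAntimagic {V : Type*} [Fintype V] [DecidableEq V] (G : SimpleGraph V)
    [DecidableRel G.Adj] : Prop :=
  ∃ f : Sym2 V → ℕ, Set.BijOn f G.edgeSet (Set.Icc 1 G.edgeFinset.card) ∧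
    ∀ u v : V, u ≠ v → ∑ e ∈ G.incidenceFinset u, f e ≠ ∑ e ∈ G.incidenceFinset v, f e

end SimpleGraph

/-!
`Fl_m × K_{1,n}` is bipartite: every edge joins a copy of some `x` over the centre of the star to a
copy of some neighbour `y` of `x` over a leaf `j`. According to the types of `x` and `y` (hub, rim,
outer, and the direction along the cycle when both are on the rim) there are eight kinds of edges,
with `m * n` edges each, parametrised by the cells `(i, j)` of an `m × n` grid. Each kind receives a
block of `m * n` consecutive labels, and the only free choice is the order `p` of the eight blocks.

Vertices also fall into kinds, six of them. The labels at a vertex come from prescribed blocks, so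
its sum lies in an interval that depends only on its kind (`flowerSum_mem_Ioc`). Within a kind the
sums are distinct whatever `p` is (`flowerSum_injOn_kind`), since inside almost every block the
labels follow the row-by-row order of the grid. The delicate point is the cycle, where such an order
cannot be respected by both neighbours. The two kinds of edges along the cycle are numbered in
opposite orders, with a shift of one row. Then the variations of their labels cancel in the sums at
the rim vertices over the centre, while at the rim vertices over the leaves the wrap-around happens
in the last two rows, where it only increases the largest sums.

It remains to choose `p` so that the six intervals are pairwise disjoint
(`isAntimagic_of_disjoint_ranges`). The hub over a leaf has degree `2 * m`, while the rim and outer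
vertices over the centre have degrees `4 * n` and `2 * n`, so no single order of the intervals suits
all `m` and `n`; one arrangement of the blocks serves `4 * m ≤ 5 * n` and another one
`5 * n ≤ 4 * m`.
-/

namespace SimpleGraph

open Finset

/-! ### Sums over incident edges and tensor products with a star -/

theorem sum_incidenceFinset {V : Type*} [Fintype V] [DecidableEq V] (G : SimpleGraph V)
    [DecidableRel G.Adj] (f : Sym2 V → ℕ) (u : V) :
    ∑ e ∈ G.incidenceFinset u, f e = ∑ w, if G.Adj u w then f s(u, w) else 0 := by
  rw [← Finset.sum_filter]
  symm
  refine Finset.sum_bij (fun w _ => s(u, w)) ?_ ?_ ?_ ?_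
  · intro w hw
    simpa [mem_incidenceFinset, mk'_mem_incidenceSet_iff] using hw
  · intro w _ w' _ h
    exact Sym2.congr_right.mp h
  · intro e he
    rw [mem_incidenceFinset] at he
    obtain ⟨w, rfl⟩ := he.2
    exact ⟨w, by simpa using he.1, rfl⟩
  · simp

theorem degree_eq_sum_ite {V : Type*} [Fintype V] [DecidableEq V] (G : SimpleGraph V)
    [DecidableRel G.Adj] (u : V) : G.degree u = ∑ w, if G.Adj u w then 1 else 0 := by
  rw [← sum_incidenceFinset _ (fun _ => 1), Finset.sum_const, card_incidenceFinset_eq_degree,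
    smul_eq_mul, mul_one]

theorem tensorProd_adj {V W : Type*} {G : SimpleGraph V} {H : SimpleGraph W} {u v : V × W} :
    (tensorProd G H).Adj u v ↔ G.Adj u.1 v.1 ∧ H.Adj u.2 v.2 :=
  Iff.rfl

theorem starK_adj {n : ℕ} {v w : Fin 1 ⊕ Fin n} :
    (starK n).Adj v w ↔ v.isLeft ∧ w.isRight ∨ v.isRight ∧ w.isLeft :=
  Iff.rfl

section TensorStar

variable {V : Type*} {n : ℕ}

/-- The edge labelling of `G × K_{1,n}` induced by a labelling of the triples `(x, y, j)`: the edge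
from the copy of `x` over the centre of the star to the copy of `y` over the `j`-th leaf receives
`L x y j`. -/
def starLabelling (L : V → V → Fin n → ℕ) : Sym2 (V × (Fin 1 ⊕ Fin n)) → ℕ :=
  let g : V × (Fin 1 ⊕ Fin n) → V × (Fin 1 ⊕ Fin n) → ℕ := fun u v =>
    match u, v with
    | (x, .inl _), (y, .inr j) => L x y j
    | _, _ => 0
  Sym2.lift ⟨fun u v => g u v + g v u, fun _ _ => add_comm _ _⟩

@[simp]
theorem starLabelling_centre_leaf (L : V → V → Fin n → ℕ) (x y : V) (c : Fin 1) (j : Fin n) :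
    starLabelling L s((x, .inl c), (y, .inr j)) = L x y j := by
  simp [starLabelling]

@[simp]
theorem starLabelling_leaf_centre (L : V → V → Fin n → ℕ) (x y : V) (c : Fin 1) (j : Fin n) :
    starLabelling L s((y, .inr j), (x, .inl c)) = L x y j := by
  simp [starLabelling]

variable [Fintype V] (G : SimpleGraph V) [DecidableRel G.Adj]

theorem sum_adj_centre (x : V) (c : Fin 1) (F : V × (Fin 1 ⊕ Fin n) → ℕ) :
    (∑ w, if (tensorProd G (starK n)).Adj (x, .inl c) w then F w else 0) =
      ∑ y, if G.Adj x y then ∑ j, F (y, .inr j) else 0 := by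
  rw [Fintype.sum_prod_type]
  refine Finset.sum_congr rfl fun y _ => ?_
  by_cases h : G.Adj x y <;> simp [tensorProd_adj, starK_adj, h]

theorem sum_adj_leaf (y : V) (j : Fin n) (F : V × (Fin 1 ⊕ Fin n) → ℕ) :
    (∑ w, if (tensorProd G (starK n)).Adj (y, .inr j) w then F w else 0) =
      ∑ x, if G.Adj y x then F (x, .inl 0) else 0 := by
  rw [Fintype.sum_prod_type]
  refine Finset.sum_congr rfl fun x _ => ?_
  by_cases h : G.Adj y x <;> simp [tensorProd_adj, starK_adj, h]

theorem sum_starLabelling_centre [DecidableEq V] (L : V → V → Fin n → ℕ) (x : V) (c : Fin 1) :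
    ∑ e ∈ (tensorProd G (starK n)).incidenceFinset (x, .inl c), starLabelling L e =
      ∑ y, if G.Adj x y then ∑ j, L x y j else 0 := by
  simp only [sum_incidenceFinset, sum_adj_centre, starLabelling_centre_leaf]

theorem sum_starLabelling_leaf [DecidableEq V] (L : V → V → Fin n → ℕ) (y : V) (j : Fin n) :
    ∑ e ∈ (tensorProd G (starK n)).incidenceFinset (y, .inr j), starLabelling L e =
      ∑ x, if G.Adj y x then L x y j else 0 := by
  simp only [sum_incidenceFinset, sum_adj_leaf, starLabelling_leaf_centre]

theorem card_edgeFinset_tensorProd_starK [DecidableEq V] :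
    (tensorProd G (starK n)).edgeFinset.card = n * ∑ x, G.degree x := by
  have h := (tensorProd G (starK n)).sum_degrees_eq_twice_card_edges
  have hc : ∀ x, (tensorProd G (starK n)).degree (x, .inl 0) = n * G.degree x := fun x => by
    rw [degree_eq_sum_ite, sum_adj_centre, degree_eq_sum_ite, Finset.mul_sum]
    simp
  have hl : ∀ x j, (tensorProd G (starK n)).degree (x, .inr j) = G.degree x := fun x j => by
    rw [degree_eq_sum_ite, sum_adj_leaf, degree_eq_sum_ite]
  rw [Fintype.sum_prod_type] at h
  simp only [Fintype.sum_sum_type, Finset.univ_unique, Finset.sum_singleton, Fin.default_eq_zero,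
    hc, hl, Finset.sum_const, Finset.card_univ, Fintype.card_fin, smul_eq_mul,
    ← two_mul, ← Finset.mul_sum] at h
  lia

/-- A labelling that takes every value of `{1, …, q}` on the `q` edges is a bijection onto
`{1, …, q}`, provided it takes no other values. -/
theorem bijOn_starLabelling (L : V → V → Fin n → ℕ)
    (hmaps : ∀ x y j, G.Adj x y → L x y j ∈ Set.Icc 1 (tensorProd G (starK n)).edgeFinset.card)
    (hsurj : ∀ v ∈ Set.Icc 1 (tensorProd G (starK n)).edgeFinset.card,
      ∃ x y j, G.Adj x y ∧ L x y j = v) :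
    Set.BijOn (starLabelling L) (tensorProd G (starK n)).edgeSet
      (Set.Icc 1 (tensorProd G (starK n)).edgeFinset.card) := by
  have hs : Set.SurjOn (starLabelling L) (tensorProd G (starK n)).edgeFinset
      (Finset.Icc 1 (tensorProd G (starK n)).edgeFinset.card : Finset ℕ) := by
    intro v hv
    obtain ⟨x, y, j, hxy, rfl⟩ := hsurj v (by simpa using hv)
    exact ⟨s((x, .inl 0), (y, .inr j)), by simp [tensorProd_adj, starK_adj, hxy], by simp⟩
  have hm : Set.MapsTo (starLabelling L) (tensorProd G (starK n)).edgeFinset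
      (Finset.Icc 1 (tensorProd G (starK n)).edgeFinset.card : Finset ℕ) := by
    intro e he
    induction e with
    | h u v =>
      obtain ⟨x, c | j⟩ := u <;> obtain ⟨y, c' | j'⟩ := v <;>
        simp only [coe_edgeFinset, mem_edgeSet, tensorProd_adj, starK_adj,
          Sum.isLeft_inl, Sum.isRight_inl, Sum.isLeft_inr, Sum.isRight_inr] at he
      · simp at he
      · simpa using hmaps x y j' he.1
      · simpa using hmaps y x j he.1.symm
      · simp at he
  have hi := Finset.injOn_of_surjOn_of_card_le _ hm hs (by simp)
  simp only [coe_edgeFinset, Finset.coe_Icc] at hs hm hi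
  exact ⟨hm, hi, hs⟩

end TensorStar

/-! ### Neighbours in the flower graph -/

section Flower

variable {m : ℕ}

theorem fin_add_one_ne_sub_one [NeZero m] (hm : 3 ≤ m) (i : Fin m) : i + 1 ≠ i - 1 := by
  obtain ⟨k, rfl⟩ := Nat.exists_eq_add_of_le' hm
  intro h
  have h2 : (1 : Fin (k + 3)) + 1 = 0 := by
    have := sub_eq_zero.mpr h
    rwa [show i + 1 - (i - 1) = (1 : Fin (k + 3)) + 1 by abel] at this
  have h3 := congrArg Fin.val h2
  rw [Fin.val_add, Fin.val_one, Nat.mod_eq_of_lt (by lia)] at h3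
  simp at h3

theorem cycleGraph_adj_iff [NeZero m] (hm : 3 ≤ m) (i k : Fin m) :
    (cycleGraph m).Adj i k ↔ k = i + 1 ∨ k = i - 1 := by
  obtain ⟨l, rfl⟩ := Nat.exists_eq_add_of_le' hm
  rw [cycleGraph_adj, or_comm, sub_eq_iff_eq_add', sub_eq_iff_eq_add', eq_sub_iff_add_eq]
  rw [eq_comm (a := i)]

theorem flowerGraph_adj_hub_some (x : Fin m ⊕ Fin m) : (flowerGraph m).Adj none (some x) :=
  trivial

theorem flowerGraph_adj_some_hub (x : Fin m ⊕ Fin m) : (flowerGraph m).Adj (some x) none :=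
  trivial

theorem flowerGraph_adj_rim_rim {i k : Fin m} :
    (flowerGraph m).Adj (some (.inl i)) (some (.inl k)) ↔ (cycleGraph m).Adj i k :=
  Iff.rfl

theorem flowerGraph_adj_rim_outer {i k : Fin m} :
    (flowerGraph m).Adj (some (.inl i)) (some (.inr k)) ↔ i = k :=
  Iff.rfl

theorem flowerGraph_adj_outer_rim {i k : Fin m} :
    (flowerGraph m).Adj (some (.inr i)) (some (.inl k)) ↔ i = k :=
  Iff.rfl

theorem flowerGraph_not_adj_outer_outer (i k : Fin m) :
    ¬ (flowerGraph m).Adj (some (.inr i)) (some (.inr k)) :=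
  id

theorem sum_flowerGraph_hub (F : Option (Fin m ⊕ Fin m) → ℕ) :
    (∑ y, if (flowerGraph m).Adj none y then F y else 0) =
      ∑ i, F (some (.inl i)) + ∑ i, F (some (.inr i)) := by
  simp [Fintype.sum_option, flowerGraph_adj_hub_some]

theorem sum_flowerGraph_rim [NeZero m] (hm : 3 ≤ m) (i : Fin m)
    (F : Option (Fin m ⊕ Fin m) → ℕ) :
    (∑ y, if (flowerGraph m).Adj (some (.inl i)) y then F y else 0) =
      F none + F (some (.inl (i + 1))) + F (some (.inl (i - 1))) + F (some (.inr i)) := by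
  have h : ∀ k : Fin m, (if k = i + 1 ∨ k = i - 1 then F (some (.inl k)) else 0) =
      (if k = i + 1 then F (some (.inl k)) else 0) +
        if k = i - 1 then F (some (.inl k)) else 0 := fun k => by
    have := fin_add_one_ne_sub_one hm i
    split_ifs <;> simp_all
  simp [Fintype.sum_option, flowerGraph_adj_some_hub, flowerGraph_adj_rim_rim,
    flowerGraph_adj_rim_outer, cycleGraph_adj_iff hm, h,
    Finset.sum_add_distrib, add_assoc]

theorem sum_flowerGraph_outer (i : Fin m) (F : Option (Fin m ⊕ Fin m) → ℕ) :
    (∑ y, if (flowerGraph m).Adj (some (.inr i)) y then F y else 0) =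
      F none + F (some (.inl i)) := by
  simp [Fintype.sum_option, flowerGraph_adj_some_hub, flowerGraph_adj_outer_rim,
    flowerGraph_not_adj_outer_outer]

theorem sum_degree_flowerGraph (hm : 3 ≤ m) : ∑ x, (flowerGraph m).degree x = 8 * m := by
  have : NeZero m := ⟨by lia⟩
  have h0 : (flowerGraph m).degree none = 2 * m := by
    rw [degree_eq_sum_ite, sum_flowerGraph_hub]
    simp [two_mul]
  have h1 : ∀ i, (flowerGraph m).degree (some (.inl i)) = 4 := fun i => by
    rw [degree_eq_sum_ite, sum_flowerGraph_rim hm]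
  have h2 : ∀ i, (flowerGraph m).degree (some (.inr i)) = 2 := fun i => by
    rw [degree_eq_sum_ite, sum_flowerGraph_outer]
  simp only [Fintype.sum_option, Fintype.sum_sum_type, h0, h1, h2, Finset.sum_const,
    Finset.card_univ, Fintype.card_fin, smul_eq_mul]
  lia

end Flower

/-! ### The labelling -/

section Labels

variable {m n : ℕ}

/-- The position `i * n + j` of the cell `(i, j)` in the row-by-row enumeration of an `m × n`
grid. -/
def gridIndex (i : Fin m) (j : Fin n) : ℕ := i * n + j

theorem gridIndex_lt (i : Fin m) (j : Fin n) : gridIndex i j < m * n := by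
  have h : (i : ℕ) * n + n ≤ m * n := by
    rw [← Nat.succ_mul]; exact Nat.mul_le_mul_right n i.isLt
  have := j.isLt
  unfold gridIndex
  lia

theorem gridIndex_inj {i i' : Fin m} {j j' : Fin n} (h : gridIndex i j = gridIndex i' j') :
    i = i' ∧ j = j' := by
  have hn : 0 < n := j.pos
  unfold gridIndex at h
  have h1 := congrArg (· / n) h
  have h2 := congrArg (· % n) h
  simp only [mul_comm _ n, Nat.mul_add_div hn, Nat.mul_add_mod, Nat.div_eq_of_lt j.isLt,
    Nat.div_eq_of_lt j'.isLt, Nat.mod_eq_of_lt j.isLt, Nat.mod_eq_of_lt j'.isLt] at h1 h2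
  exact ⟨Fin.ext (by simpa using h1), Fin.ext h2⟩

theorem exists_gridIndex {t : ℕ} (ht : t < m * n) :
    ∃ (i : Fin m) (j : Fin n), gridIndex i j = t := by
  have hn : 0 < n := Nat.pos_of_ne_zero fun h => by simp [h] at ht
  exact ⟨⟨t / n, Nat.div_lt_of_lt_mul (by rwa [mul_comm])⟩, ⟨t % n, Nat.mod_lt _ hn⟩,
    Nat.div_add_mod' t n⟩

theorem gridIndex_lt_row {i i' : Fin m} (h : i < i') (j : Fin n) :
    gridIndex i j < gridIndex i' j := by
  have := Nat.mul_lt_mul_of_pos_right (Fin.lt_def.mp h) j.pos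
  unfold gridIndex
  lia

theorem gridIndex_lt_col (i : Fin m) {j j' : Fin n} (h : j < j') :
    gridIndex i j < gridIndex i j' :=
  Nat.add_lt_add_left h _

/-- Moving down two rows cyclically adds `2 * n` to the position, modulo `m * n`. -/
theorem gridIndex_add_one_add_one [NeZero m] (hm : 3 ≤ m) (i : Fin m) (j : Fin n) :
    (gridIndex (i + 1 + 1) j = gridIndex i j + 2 * n ∧ gridIndex i j + 2 * n < m * n) ∨
      gridIndex (i + 1 + 1) j + m * n = gridIndex i j + 2 * n := by
  have hlt := gridIndex_lt (i + 1 + 1) j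
  have hi := i.isLt
  have hv : ((i + 1 + 1 : Fin m) : ℕ) = (i + 2) % m := by
    rw [Fin.val_add, Fin.val_add, Fin.val_one', Nat.mod_eq_of_lt (show 1 < m by lia),
      Nat.mod_add_mod]
  by_cases h : (i : ℕ) + 2 < m
  · left
    rw [Nat.mod_eq_of_lt h] at hv
    have : gridIndex (i + 1 + 1) j = gridIndex i j + 2 * n := by
      unfold gridIndex; rw [hv]; ring
    exact ⟨this, this ▸ hlt⟩
  · right
    rw [Nat.mod_eq_sub_mod (by lia), Nat.mod_eq_of_lt (by lia)] at hv
    have : ((i + 1 + 1 : Fin m) : ℕ) + m = i + 2 := by lia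
    have h2 := congrArg (· * n) this
    simp only [add_mul] at h2
    unfold gridIndex
    lia

/-- The label of the edge of `Fl_m × K_{1,n}` from the vertex of `Fl_m` over the centre of the star
(first argument) to the vertex of `Fl_m` over the `j`-th leaf (second argument). There are eight
kinds of edges, `m * n` of each; those of kind `k` receive the labels `p k * (m * n) + 1, …, (p k +
1) * (m * n)`, where `k = 0, …, 7` stands for hub-rim, hub-outer, rim-hub, outer-hub, forwards along
the cycle, backwards along the cycle, rim-outer, outer-rim. Inside a block the labels follow the
grid order, except that for the edges along the cycle the row is the one of the successor of the
first endpoint, and the edges that go backwards along the cycle are numbered in the reverse order.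
The value on pairs of nonadjacent vertices is irrelevant. -/
def flowerLabel [NeZero m] (p : Fin 8 → ℕ) :
    Option (Fin m ⊕ Fin m) → Option (Fin m ⊕ Fin m) → Fin n → ℕ
  | none, some (.inl i), j => p 0 * (m * n) + gridIndex i j + 1
  | none, some (.inr i), j => p 1 * (m * n) + gridIndex i j + 1
  | some (.inl i), none, j => p 2 * (m * n) + gridIndex i j + 1
  | some (.inr i), none, j => p 3 * (m * n) + gridIndex i j + 1
  | some (.inl i), some (.inl k), j =>
    if k = i + 1 then p 4 * (m * n) + gridIndex (i + 1) j + 1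
    else p 5 * (m * n) + (m * n - gridIndex (i + 1) j)
  | some (.inl i), some (.inr _), j => p 6 * (m * n) + gridIndex i j + 1
  | some (.inr i), some (.inl _), j => p 7 * (m * n) + gridIndex i j + 1
  | none, none, _ => 0
  | some (.inr _), some (.inr _), _ => 0

theorem flowerLabel_mem_Icc [NeZero m] {p : Fin 8 → ℕ} (hp : ∀ k, p k < 8)
    {x y : Option (Fin m ⊕ Fin m)} (h : (flowerGraph m).Adj x y) (j : Fin n) :
    flowerLabel p x y j ∈ Set.Icc 1 (8 * m * n) := by
  have hN : ∀ k, p k * (m * n) + m * n ≤ 8 * m * n := fun k => by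
    have := Nat.mul_le_mul_right (m * n) (Nat.succ_le_of_lt (hp k))
    rw [Nat.succ_mul] at this
    lia
  rw [Set.mem_Icc]
  rcases x with _ | i | i <;> rcases y with _ | k | k
  · exact h.elim
  · have := gridIndex_lt k j; have := hN 0; simp only [flowerLabel]; lia
  · have := gridIndex_lt k j; have := hN 1; simp only [flowerLabel]; lia
  · have := gridIndex_lt i j; have := hN 2; simp only [flowerLabel]; lia
  · have := gridIndex_lt (i + 1) j; have := hN 4; have := hN 5
    simp only [flowerLabel]
    split_ifs <;> lia
  · have := gridIndex_lt i j; have := hN 6; simp only [flowerLabel]; lia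
  · have := gridIndex_lt i j; have := hN 3; simp only [flowerLabel]; lia
  · have := gridIndex_lt i j; have := hN 7; simp only [flowerLabel]; lia
  · exact h.elim

theorem exists_flowerLabel_eq [NeZero m] (hm : 3 ≤ m) {p : Fin 8 → ℕ}
    (hp : ∀ b < 8, ∃ k, p k = b) {v : ℕ} (hv : v ∈ Set.Icc 1 (8 * m * n)) :
    ∃ x y j, (flowerGraph m).Adj x y ∧ flowerLabel (n := n) p x y j = v := by
  obtain ⟨h1, h8⟩ := hv
  have hN : 0 < m * n := Nat.pos_of_ne_zero fun h => by rw [mul_assoc, h] at h8; lia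
  obtain ⟨k, hk⟩ := hp ((v - 1) / (m * n)) (Nat.div_lt_of_lt_mul (by lia))
  have hv := Nat.div_add_mod' (v - 1) (m * n)
  have hr := Nat.mod_lt (v - 1) hN
  rw [← hk] at hv
  set r := (v - 1) % (m * n)
  obtain ⟨i, j, hij⟩ := exists_gridIndex hr
  -- The cell for the block of backward edges, which is numbered in the reverse order.
  obtain ⟨i', j', hij'⟩ := exists_gridIndex (show m * n - 1 - r < m * n by lia)
  fin_cases k <;> simp only [Fin.reduceFinMk, Fin.mk_zero, Fin.mk_one] at hv
  · exact ⟨none, some (.inl i), j, trivial, by simp only [flowerLabel]; lia⟩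
  · exact ⟨none, some (.inr i), j, trivial, by simp only [flowerLabel]; lia⟩
  · exact ⟨some (.inl i), none, j, trivial, by simp only [flowerLabel]; lia⟩
  · exact ⟨some (.inr i), none, j, trivial, by simp only [flowerLabel]; lia⟩
  · refine ⟨some (.inl (i - 1)), some (.inl i), j,
      (cycleGraph_adj_iff hm _ _).mpr (.inl (sub_add_cancel i 1).symm), ?_⟩
    simp only [flowerLabel, sub_add_cancel, if_true]
    lia
  · refine ⟨some (.inl (i' - 1)), some (.inl (i' - 1 - 1)), j',
      (cycleGraph_adj_iff hm _ _).mpr (.inr rfl), ?_⟩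
    have hne : i' - 1 - 1 ≠ i' - 1 + 1 := (fin_add_one_ne_sub_one hm _).symm
    rw [flowerLabel, if_neg hne, sub_add_cancel]
    lia
  · exact ⟨some (.inl i), some (.inr i), j, rfl, by simp only [flowerLabel]; lia⟩
  · exact ⟨some (.inr i), some (.inl i), j, rfl, by simp only [flowerLabel]; lia⟩

end Labels

/-! ### The vertex sums -/

section VertexSums

variable {m n : ℕ} [NeZero m]

/-- The sum of the labels at a vertex of `Fl_m × K_{1,n}`, for the labelling `flowerLabel p`. -/
def flowerSum (p : Fin 8 → ℕ) (u : Option (Fin m ⊕ Fin m) × (Fin 1 ⊕ Fin n)) : ℕ :=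
  ∑ e ∈ (tensorProd (flowerGraph m) (starK n)).incidenceFinset u,
    starLabelling (flowerLabel p) e

theorem flowerSum_hub_centre (p : Fin 8 → ℕ) (c : Fin 1) :
    flowerSum (m := m) (n := n) p (none, .inl c) =
      ∑ i : Fin m, ∑ j : Fin n, ((p 0 + p 1) * (m * n) + 2 * (gridIndex i j + 1)) := by
  rw [flowerSum, sum_starLabelling_centre, sum_flowerGraph_hub]
  simp only [← Finset.sum_add_distrib, flowerLabel]
  exact Finset.sum_congr rfl fun i _ => Finset.sum_congr rfl fun j _ => by ring

/-- The two edges of the `j`-th layer that run along the cycle contribute the same amount at every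
rim vertex over the centre. -/
theorem flowerSum_rim_centre (hm : 3 ≤ m) (p : Fin 8 → ℕ) (i : Fin m) (c : Fin 1) :
    flowerSum (m := m) (n := n) p (some (.inl i), .inl c) =
      ∑ j : Fin n,
        ((p 2 + p 4 + p 5 + p 6) * (m * n) + 2 * (gridIndex i j + 1) + (m * n + 1)) := by
  have hne : i - 1 ≠ i + 1 := (fin_add_one_ne_sub_one hm i).symm
  rw [flowerSum, sum_starLabelling_centre, sum_flowerGraph_rim hm]
  simp only [← Finset.sum_add_distrib, flowerLabel, if_true, if_neg hne]
  refine Finset.sum_congr rfl fun j _ => ?_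
  have := gridIndex_lt (i + 1) j
  simp only [add_mul]
  lia

theorem flowerSum_outer_centre (p : Fin 8 → ℕ) (i : Fin m) (c : Fin 1) :
    flowerSum (m := m) (n := n) p (some (.inr i), .inl c) =
      ∑ j : Fin n, ((p 3 + p 7) * (m * n) + 2 * (gridIndex i j + 1)) := by
  rw [flowerSum, sum_starLabelling_centre, sum_flowerGraph_outer]
  simp only [← Finset.sum_add_distrib, flowerLabel]
  exact Finset.sum_congr rfl fun j _ => by ring

theorem flowerSum_hub_leaf (p : Fin 8 → ℕ) (j : Fin n) :
    flowerSum (m := m) (n := n) p (none, .inr j) =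
      ∑ i : Fin m, ((p 2 + p 3) * (m * n) + 2 * (gridIndex i j + 1)) := by
  rw [flowerSum, sum_starLabelling_leaf, sum_flowerGraph_hub]
  simp only [← Finset.sum_add_distrib, flowerLabel]
  exact Finset.sum_congr rfl fun i _ => by ring

theorem flowerSum_rim_leaf (hm : 3 ≤ m) (p : Fin 8 → ℕ) (i : Fin m) (j : Fin n) :
    flowerSum (m := m) (n := n) p (some (.inl i), .inr j) =
      (p 0 + p 4 + p 5 + p 7) * (m * n) + 3 * (gridIndex i j + 1) +
        (m * n - gridIndex (i + 1 + 1) j) := by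
  have hne : i ≠ i + 1 + 1 := fun h => fin_add_one_ne_sub_one hm i (eq_sub_of_add_eq h.symm)
  rw [flowerSum, sum_starLabelling_leaf, sum_flowerGraph_rim hm]
  simp only [flowerLabel, if_neg hne, sub_add_cancel, if_true]
  ring

theorem flowerSum_outer_leaf (p : Fin 8 → ℕ) (i : Fin m) (j : Fin n) :
    flowerSum (m := m) (n := n) p (some (.inr i), .inr j) =
      (p 1 + p 6) * (m * n) + 2 * (gridIndex i j + 1) := by
  rw [flowerSum, sum_starLabelling_leaf, sum_flowerGraph_outer]
  simp only [flowerLabel]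
  ring

/-- The six kinds of vertices of `Fl_m × K_{1,n}`: the copies of the hub, of a rim vertex and of an
outer vertex over the centre of the star, followed by the same three over a leaf. -/
def vertexKind : Option (Fin m ⊕ Fin m) × (Fin 1 ⊕ Fin n) → Fin 6
  | (none, .inl _) => 0
  | (some (.inl _), .inl _) => 1
  | (some (.inr _), .inl _) => 2
  | (none, .inr _) => 3
  | (some (.inl _), .inr _) => 4
  | (some (.inr _), .inr _) => 5

/-- The degree of the vertices of each kind. -/
def kindDegree (m n : ℕ) : Fin 6 → ℕ :=
  ![2 * (m * n), 4 * n, 2 * n, 2 * m, 4, 2]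

/-- The sum of the positions of the blocks from which the edges at a vertex of each kind take their
labels. -/
def kindBase (p : Fin 8 → ℕ) (m n : ℕ) : Fin 6 → ℕ :=
  ![m * n * (p 0 + p 1), n * (p 2 + p 4 + p 5 + p 6), n * (p 3 + p 7), m * (p 2 + p 3),
    p 0 + p 4 + p 5 + p 7, p 1 + p 6]

theorem sum_fin_mem_Ioc {k a b : ℕ} (hk : 0 < k) {f : Fin k → ℕ}
    (h : ∀ i, f i ∈ Set.Ioc a b) : ∑ i, f i ∈ Set.Ioc (k * a) (k * b) := by
  have h1 := Finset.card_nsmul_le_sum univ f (a + 1) fun i _ => (h i).1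
  have h2 := Finset.sum_le_card_nsmul univ f b fun i _ => (h i).2
  rw [Finset.card_univ, Fintype.card_fin, smul_eq_mul] at h1 h2
  exact ⟨by lia, h2⟩

theorem flowerSum_mem_Ioc (hm : 3 ≤ m) (hn : 0 < n) (p : Fin 8 → ℕ)
    (u : Option (Fin m ⊕ Fin m) × (Fin 1 ⊕ Fin n)) :
    flowerSum p u ∈ Set.Ioc (kindBase p m n (vertexKind u) * (m * n))
      ((kindBase p m n (vertexKind u) + kindDegree m n (vertexKind u)) * (m * n)) := by
  have key : ∀ (b : ℕ) (i : Fin m) (j : Fin n), b * (m * n) + 2 * (gridIndex i j + 1) ∈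
      Set.Ioc (b * (m * n)) ((b + 2) * (m * n)) := fun b i j => by
    have := gridIndex_lt i j
    rw [add_mul]
    constructor <;> lia
  have hm0 : 0 < m := by lia
  obtain ⟨_ | i | i, c | j⟩ := u
  · rw [flowerSum_hub_centre]
    convert sum_fin_mem_Ioc hm0 fun i => sum_fin_mem_Ioc hn fun j => key (p 0 + p 1) i j using 2
    all_goals simp [vertexKind, kindBase, kindDegree]; ring
  · rw [flowerSum_hub_leaf]
    convert sum_fin_mem_Ioc hm0 fun i => key (p 2 + p 3) i j using 2
    all_goals simp [vertexKind, kindBase, kindDegree]; ring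
  · rw [flowerSum_rim_centre hm]
    convert sum_fin_mem_Ioc hn (a := (p 2 + p 4 + p 5 + p 6) * (m * n))
      (b := (p 2 + p 4 + p 5 + p 6 + 4) * (m * n)) fun j => ?_ using 2
    · simp [vertexKind, kindBase]; ring
    · simp [vertexKind, kindBase, kindDegree]; ring
    · have := gridIndex_lt i j
      rw [add_mul _ 4]
      constructor <;> lia
  · rw [flowerSum_rim_leaf hm]
    have := gridIndex_lt i j
    change _ ∈ Set.Ioc ((p 0 + p 4 + p 5 + p 7) * (m * n))
      ((p 0 + p 4 + p 5 + p 7 + 4) * (m * n))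
    rw [add_mul _ 4]
    constructor <;> lia
  · rw [flowerSum_outer_centre]
    convert sum_fin_mem_Ioc hn fun j => key (p 3 + p 7) i j using 2
    all_goals simp [vertexKind, kindBase, kindDegree]; ring
  · rw [flowerSum_outer_leaf]
    exact key _ i j

/-- Within one kind, the sums increase with the row or column, or with the grid position. -/
theorem flowerSum_injOn_kind (hm : 3 ≤ m) (hn : 0 < n) (p : Fin 8 → ℕ)
    {u v : Option (Fin m ⊕ Fin m) × (Fin 1 ⊕ Fin n)} (hk : vertexKind u = vertexKind v)
    (h : flowerSum p u = flowerSum p v) : u = v := by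
  have hn' : (univ : Finset (Fin n)).Nonempty := ⟨⟨0, hn⟩, mem_univ _⟩
  obtain ⟨_ | i | i, c | j⟩ := u <;> obtain ⟨_ | i' | i', c' | j'⟩ := v <;>
    simp only [vertexKind, Fin.reduceEq] at hk
  · rw [Subsingleton.elim c c']
  · rw [flowerSum_hub_leaf, flowerSum_hub_leaf] at h
    have hmono : StrictMono fun j : Fin n =>
        ∑ i : Fin m, ((p 2 + p 3) * (m * n) + 2 * (gridIndex i j + 1)) := fun a b hab =>
      Finset.sum_lt_sum_of_nonempty univ_nonempty fun i _ => by
        have := gridIndex_lt_col i hab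
        lia
    rw [hmono.injective h]
  · rw [flowerSum_rim_centre hm, flowerSum_rim_centre hm] at h
    have hmono : StrictMono fun i : Fin m => ∑ j : Fin n,
        ((p 2 + p 4 + p 5 + p 6) * (m * n) + 2 * (gridIndex i j + 1) + (m * n + 1)) :=
      fun a b hab => Finset.sum_lt_sum_of_nonempty hn' fun j _ => by
        have := gridIndex_lt_row hab j
        lia
    rw [hmono.injective h, Subsingleton.elim c c']
  · rw [flowerSum_rim_leaf hm, flowerSum_rim_leaf hm] at h
    have h1 := gridIndex_lt i j
    have h2 := gridIndex_lt i' j'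
    have h3 := gridIndex_lt (i + 1 + 1) j
    have h4 := gridIndex_lt (i' + 1 + 1) j'
    have h5 := gridIndex_add_one_add_one hm i j
    have h6 := gridIndex_add_one_add_one hm i' j'
    -- The sum is a constant plus twice the position, plus `m * n` in the last two rows.
    obtain ⟨rfl, rfl⟩ := gridIndex_inj (show gridIndex i j = gridIndex i' j' by lia)
    rfl
  · rw [flowerSum_outer_centre, flowerSum_outer_centre] at h
    have hmono : StrictMono fun i : Fin m => ∑ j : Fin n,
        ((p 3 + p 7) * (m * n) + 2 * (gridIndex i j + 1)) := fun a b hab =>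
      Finset.sum_lt_sum_of_nonempty hn' fun j _ => by
        have := gridIndex_lt_row hab j
        lia
    rw [hmono.injective h, Subsingleton.elim c c']
  · rw [flowerSum_outer_leaf, flowerSum_outer_leaf] at h
    obtain ⟨rfl, rfl⟩ := gridIndex_inj (show gridIndex i j = gridIndex i' j' by lia)
    rfl

end VertexSums

/-! ### Antimagic labellings -/

theorem card_edgeFinset_flowerGraph_tensorProd_starK {m : ℕ} (n : ℕ) (hm : 3 ≤ m) :
    (tensorProd (flowerGraph m) (starK n)).edgeFinset.card = 8 * m * n := by
  rw [card_edgeFinset_tensorProd_starK, sum_degree_flowerGraph hm, mul_comm]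

/-- An arrangement `p` of the eight blocks for which the ranges of the sums at vertices of different
kinds are disjoint yields an antimagic labelling. -/
theorem isAntimagic_of_disjoint_ranges {m n : ℕ} (hm : 3 ≤ m) (hn : 0 < n) (p : Fin 8 → ℕ)
    (hp : ∀ k, p k < 8) (hp' : ∀ b < 8, ∃ k, p k = b)
    (hd : ∀ k l, k ≠ l → kindBase p m n k + kindDegree m n k ≤ kindBase p m n l ∨
      kindBase p m n l + kindDegree m n l ≤ kindBase p m n k) :
    (tensorProd (flowerGraph m) (starK n)).IsAntimagic := by
  have : NeZero m := ⟨by lia⟩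
  refine ⟨starLabelling (flowerLabel p), ?_, fun u v huv h => ?_⟩
  · apply bijOn_starLabelling <;> rw [card_edgeFinset_flowerGraph_tensorProd_starK n hm]
    · exact fun x y j hxy => flowerLabel_mem_Icc hp hxy j
    · exact fun v hv => exists_flowerLabel_eq hm hp' hv
  · change flowerSum p u = flowerSum p v at h
    by_cases hk : vertexKind u = vertexKind v
    · exact huv (flowerSum_injOn_kind hm hn p hk h)
    · have hu := flowerSum_mem_Ioc hm hn p u
      have hv := flowerSum_mem_Ioc hm hn p v
      rw [h] at hu
      rcases hd _ _ hk with hd | hd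
      · exact absurd (hu.2.trans (Nat.mul_le_mul_right _ hd)) (not_le.mpr hv.1)
      · exact absurd (hv.2.trans (Nat.mul_le_mul_right _ hd)) (not_le.mpr hu.1)

end SimpleGraph

theorem mainTheorem3 (m n : ℕ) (hm : 3 ≤ m) (hn : 2 ≤ n) :
    (SimpleGraph.tensorProd (SimpleGraph.flowerGraph m)
        (SimpleGraph.starK n)).edgeFinset.card = 8 * m * n ∧
      (SimpleGraph.tensorProd (SimpleGraph.flowerGraph m)
        (SimpleGraph.starK n)).IsAntimagic := by
  refine ⟨SimpleGraph.card_edgeFinset_flowerGraph_tensorProd_starK n hm, ?_⟩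
  rcases le_total (4 * m) (5 * n) with h | h
  -- In increasing order: outer and rim vertices over the leaves, hub over the leaves, outer and rim
  -- vertices over the centre, hub over the centre.
  · have h1 : 3 * n ≤ m * n := Nat.mul_le_mul_right n hm
    have h2 : m * 2 ≤ m * n := Nat.mul_le_mul_left m hn
    refine SimpleGraph.isAntimagic_of_disjoint_ranges hm (by lia) ![1, 5, 0, 6, 2, 7, 3, 4]
      (by decide) (by decide) fun k l hkl => ?_
    fin_cases k <;> fin_cases l <;>
      simp [SimpleGraph.kindBase, SimpleGraph.kindDegree] at hkl ⊢ <;> lia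
  -- As before, except that the hub over the leaves now comes after the rim over the centre.
  · have h1 : 3 * n ≤ m * n := Nat.mul_le_mul_right n hm
    have h2 : m * 2 ≤ m * n := Nat.mul_le_mul_left m hn
    refine SimpleGraph.isAntimagic_of_disjoint_ranges hm (by lia) ![3, 5, 6, 7, 0, 4, 1, 2]
      (by decide) (by decide) fun k l hkl => ?_
    fin_cases k <;> fin_cases l <;>
      simp [SimpleGraph.kindBase, SimpleGraph.kindDegree] at hkl ⊢ <;> lia
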